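/- Let $H$ be a real Hilbert space with an orthonormal basis $\{e_n\}_{n\ge 0}$, and let $a_n,b_n,c_n,d_n$ ($n\ge 0$) be real numbers with $c_n+d_n=a_nb_n$ for all $n\ge 0$. Let $\mathfrak F=\{f_n\}_{n\ge 0}$ be the pentadiagonal system given, for $j\ge 0$, by $$f_{4j}=e_{4j},\qquad f_{4j+1}=-a_{2j}e_{4j}+e_{4j+1},$$ $$f_{4j+2}=e_{4j+2}+d_{2j}e_{4j}-b_{2j}e_{4j+1}+a_{2j+1}e_{4j+3}+c_{2j+1}e_{4j+4},\qquad f_{4j+3}=e_{4j+3}+b_{2j+1}e_{4j+4}.$$ Let $\mathcal A$ be the algebra of all $T\in B(H)$ for which there are real $\lambda_n$ with $Tf_n=\lambda_nf_n$ for all $n\ge 0$, and let $R_1(\mathcal A)$ be the (not necessarily unital) subalgebra generated by the rank one operators in $\mathcal A$. The system $\mathfrak F$ is called *rank one dense* if the unit ball of $R_1(\mathcal A)$ is dense in the unit ball of $\mathcal A$ in the strong operator topology; it is called *$k$ point dense* if for all $x_1,\dots,x_k\in H$ and $\varepsilon>0$ there is $T\in R_1(\mathcal A)$ with $\|Tx_s-x_s\|<\varepsilon$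 for $1\le s\le k$. Put $$\mu_n=\min\left(\frac1{|a_n|}+\frac1{|b_n|},\ \frac{1+|b_n|}{|d_n|},\ \frac{1+|a_n|}{|c_n|}\right)\in[0,\infty],$$ where a positive number divided by $0$ is $\infty$. Then the following statements are equivalent: 1. $\mathfrak F$ is rank one dense; 2. $\mathfrak F$ is $k$ point dense for some $k>1$; 3. $\mathfrak F$ is $k$ point dense for every $k>1$; 4. $\{\mu_n\}$ does not belong to $\ell^1$, disregarding finitely many terms: $\sum_{n\ge N}\mu_n=\infty$ for every $N\ge 0$. (If all $\mu_n$ are finite, this says precisely that $\{\mu_n\}\notin\ell^1$.) -/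

import Mathlib

open scoped ENNReal

namespace PentaBasis

section Density

variable {H : Type*} [NormedAddCommGroup H] [InnerProductSpace ℝ H]

/-- The algebra `𝒜` of all bounded operators `T` such that every `f n` is an eigenvector of `T`:
`T (f n) = λ n • f n` for some real `λ n`. -/
def diagAlgebra (f : ℕ → H) : Subalgebra ℝ (H →L[ℝ] H) where
  carrier := {T | ∀ n, ∃ l : ℝ, T (f n) = l • f n}
  mul_mem' := by
    intro S T hS hT n
    obtain ⟨s, hs⟩ := hS n
    obtain ⟨t, ht⟩ := hT n
    exact ⟨t * s, by simp [ht, hs, mul_smul]⟩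
  add_mem' := by
    intro S T hS hT n
    obtain ⟨s, hs⟩ := hS n
    obtain ⟨t, ht⟩ := hT n
    exact ⟨s + t, by simp [ht, hs, add_smul]⟩
  algebraMap_mem' := by
    intro r n
    exact ⟨r, by simp [Algebra.algebraMap_eq_smul_one]⟩

/-- The (not necessarily unital) algebra `R₁(𝒜)` generated by the rank one operators of `𝒜`. -/
def rankOneAlgebra (f : ℕ → H) : NonUnitalSubalgebra ℝ (H →L[ℝ] H) :=
  NonUnitalAlgebra.adjoin ℝ
    {T | T ∈ diagAlgebra f ∧ Module.finrank ℝ (LinearMap.range (T : H →ₗ[ℝ] H)) = 1}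

/-- `k` point density: any `k` vectors can be simultaneously approximated by their images under
one element of the rank one subalgebra `R₁(𝒜)`. -/
def KPointDense (f : ℕ → H) (k : ℕ) : Prop :=
  ∀ x : Fin k → H, ∀ ε : ℝ, 0 < ε → ∃ T ∈ rankOneAlgebra f, ∀ s, ‖T (x s) - x s‖ < ε

/-- Rank one density: the unit ball of `R₁(𝒜)` is dense in the unit ball of `𝒜` in the strong
operator topology, that is, in the topology of pointwise convergence on `H →L[ℝ] H`. -/
def RankOneDense (f : ℕ → H) : Prop :=
  ∀ T ∈ diagAlgebra f, ‖T‖ ≤ 1 →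
    ContinuousLinearMap.toPointwiseConvergenceCLM ℝ (RingHom.id ℝ) H H T ∈
      closure (ContinuousLinearMap.toPointwiseConvergenceCLM ℝ (RingHom.id ℝ) H H ''
        {S : H →L[ℝ] H | S ∈ rankOneAlgebra f ∧ ‖S‖ ≤ 1})

/-- The pentadiagonal system `f` built on the sequence `e` (an orthonormal basis) with
coefficients `a`, `b`, `c`, `d`. -/
def pentaSystem (e : ℕ → H) (a b c d : ℕ → ℝ) (n : ℕ) : H :=
  let j := n / 4
  match n % 4 with
  | 0 => e (4 * j)
  | 1 => -a (2 * j) • e (4 * j) + e (4 * j + 1)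
  | 2 => e (4 * j + 2) + d (2 * j) • e (4 * j) - b (2 * j) • e (4 * j + 1)
      + a (2 * j + 1) • e (4 * j + 3) + c (2 * j + 1) • e (4 * j + 4)
  | _ => e (4 * j + 3) + b (2 * j + 1) • e (4 * j + 4)

end Density

/-- The sequence `μ n = min (1/|a n| + 1/|b n|, (1 + |b n|)/|d n|, (1 + |a n|)/|c n|)` with values
in `[0, ∞]`; a positive number divided by `0` is `∞`. -/
noncomputable def mu (a b c d : ℕ → ℝ) (n : ℕ) : ℝ≥0∞ :=
  min (1 / ENNReal.ofReal |a n| + 1 / ENNReal.ofReal |b n|)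
    (min ((1 + ENNReal.ofReal |b n|) / ENNReal.ofReal |d n|)
      ((1 + ENNReal.ofReal |a n|) / ENNReal.ofReal |c n|))

/-- A sequence in `[0, ∞]` is not in `ℓ¹` (finitely many terms being irrelevant): all its tails
have infinite sum. For sequences with finite terms this is the usual notion, see
`notEllOne_iff`. -/
def NotEllOne (m : ℕ → ℝ≥0∞) : Prop :=
  ∀ N : ℕ, ∑' n, m (N + n) = ∞

theorem notEllOne_iff (m : ℕ → ℝ≥0∞) (hm : ∀ n, m n ≠ ∞) :
    NotEllOne m ↔ ¬ Memℓp (fun n => (m n).toReal) 1 := by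
  have key : ∀ N : ℕ, ∑' n, m (N + n) = ∞ ↔ ¬ Summable (fun n => (m n).toReal) := by
    intro N
    rw [← summable_nat_add_iff N]
    have h : (fun n => m (N + n)) = fun n => m (n + N) := by
      funext n; rw [add_comm]
    rw [h]
    constructor
    · intro ht hs
      have h2 : ∀ n, m (n + N) = ENNReal.ofReal (m (n + N)).toReal := fun n =>
        (ENNReal.ofReal_toReal (hm _)).symm
      rw [tsum_congr h2, ← ENNReal.ofReal_tsum_of_nonneg (fun n => ENNReal.toReal_nonneg) hs] at ht
      exact ENNReal.ofReal_ne_top ht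
    · intro hs
      by_contra ht
      exact hs (ENNReal.summable_toReal ht)
  have hp : Memℓp (fun n => (m n).toReal) 1 ↔ Summable (fun n => (m n).toReal) := by
    rw [memℓp_gen_iff (by norm_num)]
    simp
  rw [hp]
  exact ⟨fun h => (key 0).1 (h 0), fun h N => (key N).2 h⟩

end PentaBasis

/-! The system has a finitely supported biorthogonal system `g`, and its span is dense. Hence the
rank one operators of the algebra are multiples of `f n ⊗ g n`, and the rank one algebra is their
linear span (`mem_rankOneAlgebra_iff`).

Divergence gives density. In the basis `e`, an operator with finitely supported eigenvalues `κ` is a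
diagonal plus six weighted shifts with weights `a (κ - κ')`, `b (κ' - κ'')` and `c (κ - κ') - d (κ'
- κ'')` at consecutive eigenvalues. With weights bounded by 1, the eigenvalue can drop at step `n`
by `min (μ n) 1 / 2` (`exists_step`). If the tails of `μ` diverge, `κ` can descend from 1 to 0 with
weights at most `ε` (`exists_eigenvalues`). The resulting operators have norm at most `1 + 7 ε` and
tend strongly to the identity; multiplying them by `T` and normalising approximates `T`.

Two point density gives divergence. If some tail of `μ` is summable, there are vectors with `⟪T x,
u⟫ + ⟪T y, v⟫ = 0` on the rank one algebra but `⟪x, u⟫ + ⟪y, v⟫ = 1` (`exists_rankTwoForm`), so `x,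
y` cannot be approximated together. The entries of this rank two functional are dot products of
planar vectors; the prescribed ones are weights `α, γ, δ` of size at most `μ n` (`exists_weights`),
and `exists_polar` realises them with square summable lengths. -/

namespace PentaBasis

open InnerProductSpace Filter Topology

/-! ### Biorthogonal systems and their rank one algebras. -/

section Biorthogonal

variable {H : Type*} [NormedAddCommGroup H] [InnerProductSpace ℝ H]

/-- Two sequences that are biorthogonal, the first of which spans a dense subspace. -/
structure IsBiorthogonalBasis (f g : ℕ → H) : Prop where
  inner_eq : ∀ m n, inner ℝ (g m) (f n) = if m = n then 1 else 0
  dense_span : Dense (Submodule.span ℝ (Set.range f) : Set H)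

theorem ext_of_dense_span {f : ℕ → H} (hf : Dense (Submodule.span ℝ (Set.range f) : Set H))
    {S T : H →L[ℝ] H} (h : ∀ n, S (f n) = T (f n)) : S = T := by
  refine ContinuousLinearMap.ext_on hf ?_
  rintro _ ⟨n, rfl⟩
  exact h n

namespace IsBiorthogonalBasis

variable {f g : ℕ → H}

theorem ne_zero (h : IsBiorthogonalBasis f g) (n : ℕ) : f n ≠ 0 := by
  intro h0
  have := h.inner_eq n n
  simp [h0] at this

theorem dual_ne_zero (h : IsBiorthogonalBasis f g) (n : ℕ) : g n ≠ 0 := by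
  intro h0
  have := h.inner_eq n n
  simp [h0] at this

theorem rankOne_apply (h : IsBiorthogonalBasis f g) (m n : ℕ) :
    rankOne ℝ (f m) (g m) (f n) = (if m = n then (1 : ℝ) else 0) • f n := by
  rw [InnerProductSpace.rankOne_apply, h.inner_eq]
  split_ifs with hmn
  · rw [hmn]
  · simp

theorem mul_rankOne {T : H →L[ℝ] H} {n : ℕ} {l : ℝ} (hT : T (f n) = l • f n) :
    T * rankOne ℝ (f n) (g n) = l • rankOne ℝ (f n) (g n) := by
  ext x
  simp [hT, smul_smul, mul_comm]

theorem rankOne_mem_diagAlgebra (h : IsBiorthogonalBasis f g) (n : ℕ) :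
    rankOne ℝ (f n) (g n) ∈ diagAlgebra f :=
  fun m => ⟨_, h.rankOne_apply n m⟩

theorem rankOne_mem_rankOneAlgebra (h : IsBiorthogonalBasis f g) (n : ℕ) :
    rankOne ℝ (f n) (g n) ∈ rankOneAlgebra f := by
  refine NonUnitalAlgebra.subset_adjoin ℝ ⟨h.rankOne_mem_diagAlgebra n, ?_⟩
  have := rank_rankOne (𝕜 := ℝ) (x := f n) (y := g n) (h.ne_zero n) (h.dual_ne_zero n)
  rw [LinearMap.rank] at this
  exact Module.finrank_eq_of_rank_eq (by simpa using this)

/-- Every `f n` with nonzero eigenvalue lies in the range and the `f n` are independent, so exactly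
one eigenvalue survives; density of the span then determines `T`. -/
theorem mem_span_of_finrank_range (h : IsBiorthogonalBasis f g) {T : H →L[ℝ] H}
    (hT : T ∈ diagAlgebra f)
    (hr : Module.finrank ℝ (LinearMap.range (T : H →ₗ[ℝ] H)) = 1) :
    T ∈ Submodule.span ℝ (Set.range fun n => rankOne ℝ (f n) (g n)) := by
  choose l hl using hT
  have hex : ∃ n, l n ≠ 0 := by
    by_contra! h0
    have : T = 0 := ext_of_dense_span h.dense_span fun n => by simp [hl, h0]
    obtain ⟨⟨v, x, hx⟩, hv, -⟩ := finrank_eq_one_iff'.1 hr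
    refine hv (Subtype.ext ?_)
    have hx0 : T x = v := hx
    rw [this] at hx0
    exact hx0.symm
  obtain ⟨n, hn⟩ := hex
  have hzero : ∀ m, m ≠ n → l m = 0 := by
    intro m hmn
    by_contra hm
    have hmem : ∀ i, l i ≠ 0 → f i ∈ LinearMap.range (T : H →ₗ[ℝ] H) := fun i hi =>
      ⟨(l i)⁻¹ • f i, by simp [hl, smul_smul, hi]⟩
    obtain ⟨r, hr'⟩ := (finrank_eq_one_iff_of_nonzero'
      (⟨f n, hmem n hn⟩ : LinearMap.range (T : H →ₗ[ℝ] H))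
      (by simpa [Subtype.ext_iff] using h.ne_zero n)).1 hr ⟨f m, hmem m hm⟩
    have h1 : r • f n = f m := congrArg Subtype.val hr'
    have h2 := congrArg (inner ℝ (g m)) h1
    rw [inner_smul_right, h.inner_eq, h.inner_eq] at h2
    simp [hmn] at h2
  have : T = l n • rankOne ℝ (f n) (g n) := ext_of_dense_span h.dense_span fun m => by
    rw [hl, smul_apply, h.rankOne_apply]
    by_cases hmn : n = m
    · simp [hmn]
    · simp [hmn, hzero m (Ne.symm hmn)]
  rw [this]
  exact Submodule.smul_mem _ _ (Submodule.subset_span ⟨n, rfl⟩)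

theorem mem_rankOneAlgebra_iff (h : IsBiorthogonalBasis f g) {T : H →L[ℝ] H} :
    T ∈ rankOneAlgebra f ↔
      T ∈ Submodule.span ℝ (Set.range fun n => rankOne ℝ (f n) (g n)) := by
  constructor
  · intro hT
    refine NonUnitalAlgebra.adjoin_induction (s := {T | T ∈ diagAlgebra f ∧
      Module.finrank ℝ (LinearMap.range (T : H →ₗ[ℝ] H)) = 1})
      (p := fun T _ => T ∈ Submodule.span ℝ (Set.range fun n => rankOne ℝ (f n) (g n)))
      ?_ ?_ ?_ ?_ ?_ hT
    · exact fun T hT => h.mem_span_of_finrank_range hT.1 hT.2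
    · exact fun S T _ _ hS hT => Submodule.add_mem _ hS hT
    · exact Submodule.zero_mem _
    · intro S T _ _ hS hT
      -- The span is closed under products because a diagonal left factor merely rescales each `f n
      -- ⊗ g n`.
      have hS' : S ∈ diagAlgebra f := by
        have hle : Submodule.span ℝ (Set.range fun n => rankOne ℝ (f n) (g n)) ≤
            Subalgebra.toSubmodule (diagAlgebra f) := by
          rw [Submodule.span_le]
          rintro _ ⟨n, rfl⟩
          exact h.rankOne_mem_diagAlgebra n
        exact hle hS
      clear * - hT hS' h
      induction hT using Submodule.span_induction with
      | mem T hT =>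
        obtain ⟨n, rfl⟩ := hT
        obtain ⟨l, hl⟩ := hS' n
        rw [mul_rankOne hl]
        exact Submodule.smul_mem _ _ (Submodule.subset_span ⟨n, rfl⟩)
      | zero => simp
      | add T T' _ _ hT hT' => rw [mul_add]; exact Submodule.add_mem _ hT hT'
      | smul r T _ hT => rw [mul_smul_comm]; exact Submodule.smul_mem _ _ hT
    · exact fun r T _ hT => Submodule.smul_mem _ _ hT
  · intro hT
    induction hT using Submodule.span_induction with
    | mem T hT =>
      obtain ⟨n, rfl⟩ := hT
      exact h.rankOne_mem_rankOneAlgebra n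
    | zero => exact zero_mem _
    | add T T' _ _ hT hT' => exact add_mem hT hT'
    | smul r T _ hT => exact SMulMemClass.smul_mem r hT

/-- An operator with finitely many nonzero eigenvalues lies in the rank one algebra. -/
theorem mem_rankOneAlgebra_of_eventually_zero (h : IsBiorthogonalBasis f g)
    {T : H →L[ℝ] H} {l : ℕ → ℝ}
    (hT : ∀ n, T (f n) = l n • f n) {N : ℕ} (hN : ∀ n, N ≤ n → l n = 0) :
    T ∈ rankOneAlgebra f := by
  have : T = ∑ n ∈ Finset.range N, l n • rankOne ℝ (f n) (g n) :=
    ext_of_dense_span h.dense_span fun m => by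
      rw [hT, sum_apply]
      simp only [smul_apply, h.rankOne_apply, ite_smul, one_smul, zero_smul,
        smul_ite, smul_zero, Finset.sum_ite_eq', Finset.mem_range]
      split_ifs with hm
      · rfl
      · simp [hN m (not_lt.1 hm)]
  rw [this]
  exact sum_mem fun n _ => SMulMemClass.smul_mem _ (h.rankOne_mem_rankOneAlgebra n)

end IsBiorthogonalBasis

end Biorthogonal

/-! ### The dual system and completeness. -/

section System

variable {H : Type*} [NormedAddCommGroup H] [InnerProductSpace ℝ H]

/-- The system biorthogonal to `pentaSystem`. -/
def pentaDual (e : ℕ → H) (a b c d : ℕ → ℝ) (n : ℕ) : H :=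
  let j := n / 4
  match n % 4 with
  | 0 => e (4 * j) + a (2 * j) • e (4 * j + 1) + c (2 * j) • e (4 * j + 2)
      + if j = 0 then 0 else
          d (2 * (j - 1) + 1) • e (4 * (j - 1) + 2) - b (2 * (j - 1) + 1) • e (4 * (j - 1) + 3)
  | 1 => e (4 * j + 1) + b (2 * j) • e (4 * j + 2)
  | 2 => e (4 * j + 2)
  | _ => e (4 * j + 3) - a (2 * j + 1) • e (4 * j + 2)

variable (e : ℕ → H) (a b c d : ℕ → ℝ)

theorem forall_nat_mod_four {p : ℕ → Prop} (h0 : ∀ j, p (4 * j)) (h1 : ∀ j, p (4 * j + 1))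
    (h2 : ∀ j, p (4 * j + 2)) (h3 : ∀ j, p (4 * j + 3)) (n : ℕ) : p n := by
  have hn : 4 * (n / 4) + n % 4 = n := Nat.div_add_mod n 4
  have : n % 4 < 4 := Nat.mod_lt _ (by norm_num)
  rw [← hn]
  interval_cases n % 4
  exacts [h0 _, h1 _, h2 _, h3 _]

theorem pentaSystem_zero (j : ℕ) : pentaSystem e a b c d (4 * j) = e (4 * j) := by
  simp [pentaSystem]

theorem pentaSystem_one (j : ℕ) : pentaSystem e a b c d (4 * j + 1) =
    -a (2 * j) • e (4 * j) + e (4 * j + 1) := by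
  have h1 : (4 * j + 1) % 4 = 1 := by omega
  have h2 : (4 * j + 1) / 4 = j := by omega
  simp only [pentaSystem, h1, h2]

theorem pentaSystem_two (j : ℕ) : pentaSystem e a b c d (4 * j + 2) =
    e (4 * j + 2) + d (2 * j) • e (4 * j) - b (2 * j) • e (4 * j + 1)
      + a (2 * j + 1) • e (4 * j + 3) + c (2 * j + 1) • e (4 * (j + 1)) := by
  have h1 : (4 * j + 2) % 4 = 2 := by omega
  have h2 : (4 * j + 2) / 4 = j := by omega
  simp only [pentaSystem, h1, h2, mul_add, mul_one]

theorem pentaSystem_three (j : ℕ) : pentaSystem e a b c d (4 * j + 3) =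
    e (4 * j + 3) + b (2 * j + 1) • e (4 * (j + 1)) := by
  have h1 : (4 * j + 3) % 4 = 3 := by omega
  have h2 : (4 * j + 3) / 4 = j := by omega
  simp only [pentaSystem, h1, h2, mul_add, mul_one]

theorem pentaDual_zero : pentaDual e a b c d (4 * 0) =
    e (4 * 0) + a (2 * 0) • e (4 * 0 + 1) + c (2 * 0) • e (4 * 0 + 2) := by
  simp [pentaDual]

theorem pentaDual_four (j : ℕ) : pentaDual e a b c d (4 * (j + 1)) =
    e (4 * (j + 1)) + a (2 * (j + 1)) • e (4 * (j + 1) + 1) + c (2 * (j + 1)) • e (4 * (j + 1) + 2)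
      + (d (2 * j + 1) • e (4 * j + 2) - b (2 * j + 1) • e (4 * j + 3)) := by
  have h1 : (4 * (j + 1)) % 4 = 0 := by omega
  have h2 : (4 * (j + 1)) / 4 = j + 1 := by omega
  simp only [pentaDual, h1, h2]
  simp

theorem pentaDual_one (j : ℕ) : pentaDual e a b c d (4 * j + 1) =
    e (4 * j + 1) + b (2 * j) • e (4 * j + 2) := by
  have h1 : (4 * j + 1) % 4 = 1 := by omega
  have h2 : (4 * j + 1) / 4 = j := by omega
  simp only [pentaDual, h1, h2]

theorem pentaDual_two (j : ℕ) : pentaDual e a b c d (4 * j + 2) = e (4 * j + 2) := by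
  have h1 : (4 * j + 2) % 4 = 2 := by omega
  have h2 : (4 * j + 2) / 4 = j := by omega
  simp only [pentaDual, h1, h2]

theorem pentaDual_three (j : ℕ) : pentaDual e a b c d (4 * j + 3) =
    e (4 * j + 3) - a (2 * j + 1) • e (4 * j + 2) := by
  have h1 : (4 * j + 3) % 4 = 3 := by omega
  have h2 : (4 * j + 3) / 4 = j := by omega
  simp only [pentaDual, h1, h2]

variable {e a b c d}

-- The relation `c + d = a b` matters only for the dual vectors at `4 j` and `4 (j + 1)` against the
-- system vector at `4 j + 2`; other off-diagonal pairings vanish or cancel at once.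
set_option linter.unusedSimpArgs false in
theorem inner_dual_system (he : Orthonormal ℝ e) (hcd : ∀ n, c n + d n = a n * b n) (m n : ℕ) :
    inner ℝ (pentaDual e a b c d m) (pentaSystem e a b c d n) = if m = n then 1 else 0 := by
  have hE : ∀ i j, inner ℝ (e i) (e j) = if i = j then (1 : ℝ) else 0 := fun i j =>
    (orthonormal_iff_ite.1 he) i j
  have r1 : ∀ i j : ℕ, (4 * i = 4 * j + 1) = False := fun i j => by simp; omega
  have r2 : ∀ i j : ℕ, (4 * i = 4 * j + 2) = False := fun i j => by simp; omega
  have r3 : ∀ i j : ℕ, (4 * i = 4 * j + 3) = False := fun i j => by simp; omega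
  have r4 : ∀ i j : ℕ, (4 * i + 1 = 4 * j) = False := fun i j => by simp; omega
  have r5 : ∀ i j : ℕ, (4 * i + 1 = 4 * j + 2) = False := fun i j => by simp; omega
  have r6 : ∀ i j : ℕ, (4 * i + 1 = 4 * j + 3) = False := fun i j => by simp; omega
  have r7 : ∀ i j : ℕ, (4 * i + 2 = 4 * j) = False := fun i j => by simp; omega
  have r8 : ∀ i j : ℕ, (4 * i + 2 = 4 * j + 1) = False := fun i j => by simp; omega
  have r9 : ∀ i j : ℕ, (4 * i + 2 = 4 * j + 3) = False := fun i j => by simp; omega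
  have s1 : ∀ i j : ℕ, (4 * i + 3 = 4 * j) = False := fun i j => by simp; omega
  have s2 : ∀ i j : ℕ, (4 * i + 3 = 4 * j + 1) = False := fun i j => by simp; omega
  have s3 : ∀ i j : ℕ, (4 * i + 3 = 4 * j + 2) = False := fun i j => by simp; omega
  have t0 : ∀ i j : ℕ, (4 * i = 4 * j) = (i = j) := fun i j => by simp
  have t1 : ∀ i j k : ℕ, (4 * i + k = 4 * j + k) = (i = j) := fun i j k => by simp
  have key : ∀ {n}, c n = a n * b n - d n := fun {n} => by linarith [hcd n]
  induction m using forall_nat_mod_four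
  case h0 i =>
    rcases i with _ | i <;> induction n using forall_nat_mod_four <;>
    simp only [pentaDual_zero, pentaDual_four, pentaDual_one, pentaDual_two, pentaDual_three,
      pentaSystem_zero, pentaSystem_one, pentaSystem_two, pentaSystem_three, inner_add_left,
      inner_add_right, inner_sub_left, inner_sub_right, real_inner_smul_left,
      real_inner_smul_right, hE, r1, r2, r3, r4, r5, r6, r7, r8, r9, s1, s2, s3, t0, t1, if_false] <;>
    (try split_ifs) <;> (try contradiction) <;> (try omega) <;> (try subst_vars) <;>
    (try simp [key]) <;> ring
  all_goals
    induction n using forall_nat_mod_four <;>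
    simp only [pentaDual_zero, pentaDual_four, pentaDual_one, pentaDual_two, pentaDual_three,
      pentaSystem_zero, pentaSystem_one, pentaSystem_two, pentaSystem_three, inner_add_left,
      inner_add_right, inner_sub_left, inner_sub_right, real_inner_smul_left,
      real_inner_smul_right, hE, r1, r2, r3, r4, r5, r6, r7, r8, r9, s1, s2, s3, t0, t1, if_false] <;>
    (try split_ifs) <;> (try subst_vars) <;> simp [key]

theorem mem_span_pentaSystem (e : ℕ → H) (a b c d : ℕ → ℝ) (n : ℕ) :
    e n ∈ Submodule.span ℝ (Set.range (pentaSystem e a b c d)) := by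
  set V := Submodule.span ℝ (Set.range (pentaSystem e a b c d))
  have hf : ∀ n, pentaSystem e a b c d n ∈ V := fun n => Submodule.subset_span ⟨n, rfl⟩
  have h0 : ∀ j, e (4 * j) ∈ V := fun j => by
    rw [← pentaSystem_zero e a b c d]
    exact hf _
  have h1 : ∀ j, e (4 * j + 1) ∈ V := fun j => by
    have := V.add_mem (hf (4 * j + 1)) (V.smul_mem (a (2 * j)) (h0 j))
    rw [pentaSystem_one] at this
    convert! this using 1
    module
  have h3 : ∀ j, e (4 * j + 3) ∈ V := fun j => by
    have := V.sub_mem (hf (4 * j + 3)) (V.smul_mem (b (2 * j + 1)) (h0 (j + 1)))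
    rw [pentaSystem_three] at this
    convert! this using 1
    module
  induction n using forall_nat_mod_four with
  | h0 j => exact h0 j
  | h1 j => exact h1 j
  | h2 j =>
    have := V.sub_mem (V.sub_mem (V.add_mem (V.sub_mem (hf (4 * j + 2))
      (V.smul_mem (d (2 * j)) (h0 j))) (V.smul_mem (b (2 * j)) (h1 j)))
      (V.smul_mem (a (2 * j + 1)) (h3 j))) (V.smul_mem (c (2 * j + 1)) (h0 (j + 1)))
    rw [pentaSystem_two] at this
    convert! this using 1
    module
  | h3 j => exact h3 j

theorem isBiorthogonalBasis_pentaSystem (e : HilbertBasis ℕ ℝ H)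
    (hcd : ∀ n, c n + d n = a n * b n) :
    IsBiorthogonalBasis (pentaSystem e a b c d) (pentaDual e a b c d) where
  inner_eq := inner_dual_system e.orthonormal hcd
  dense_span := by
    have h1 : Dense (Submodule.span ℝ (Set.range e) : Set H) :=
      Submodule.dense_iff_topologicalClosure_eq_top.2 e.dense_span
    refine h1.mono (Submodule.span_le.2 ?_)
    rintro _ ⟨n, rfl⟩
    exact mem_span_pentaSystem e a b c d n

end System

/-! ### Norms of finite weighted shifts. -/

section WeightedShift

variable {H : Type*} [NormedAddCommGroup H] [InnerProductSpace ℝ H]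

/-- The finite weighted shift sending `e (g j)` to `w j • e (h j)` for `j < J`. -/
noncomputable def weightedShift (e : ℕ → H) (J : ℕ) (w : ℕ → ℝ) (h g : ℕ → ℕ) : H →L[ℝ] H :=
  ∑ j ∈ Finset.range J, w j • rankOne ℝ (e (h j)) (e (g j))

variable {e : ℕ → H} {J : ℕ} {w : ℕ → ℝ} {h g : ℕ → ℕ}

theorem weightedShift_apply (x : H) : weightedShift e J w h g x =
    ∑ j ∈ Finset.range J, (w j * inner ℝ (e (g j)) x) • e (h j) := by
  simp [weightedShift, sum_apply, mul_smul]

theorem weightedShift_apply_of_ne (he : Orthonormal ℝ e) {m : ℕ} (hm : ∀ j, g j ≠ m) :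
    weightedShift e J w h g (e m) = 0 := by
  rw [weightedShift_apply]
  refine Finset.sum_eq_zero fun j _ => ?_
  rw [he.2 (hm j), mul_zero, zero_smul]

theorem weightedShift_apply_self (he : Orthonormal ℝ e) (hg : g.Injective)
    (hw : ∀ j, J ≤ j → w j = 0) (j : ℕ) :
    weightedShift e J w h g (e (g j)) = w j • e (h j) := by
  rw [weightedShift_apply]
  simp only [orthonormal_iff_ite.1 he, hg.eq_iff, mul_ite, mul_one, mul_zero, ite_smul, zero_smul,
    Finset.sum_ite_eq', Finset.mem_range]
  split_ifs with hj
  · rfl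
  · rw [hw j (not_lt.1 hj), zero_smul]

/-- Pythagoras for the targets (`h` injective), then Bessel for the sources (`g` injective). -/
theorem norm_weightedShift_le (he : Orthonormal ℝ e) (hg : g.Injective) (hh : h.Injective)
    {C : ℝ} (hC : 0 ≤ C) (hw : ∀ j, |w j| ≤ C) : ‖weightedShift e J w h g‖ ≤ C := by
  refine ContinuousLinearMap.opNorm_le_bound _ hC fun x => ?_
  refine le_of_sq_le_sq ?_ (by positivity)
  rw [weightedShift_apply]
  have hsq : ‖∑ j ∈ Finset.range J, (w j * inner ℝ (e (g j)) x) • e (h j)‖ ^ 2 =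
      ∑ j ∈ Finset.range J, (w j * inner ℝ (e (g j)) x) ^ 2 := by
    rw [← real_inner_self_eq_norm_sq]
    have := (he.comp h hh).inner_sum (fun j => w j * inner ℝ (e (g j)) x)
      (fun j => w j * inner ℝ (e (g j)) x) (Finset.range J)
    simp only [Function.comp_apply] at this
    rw [this]
    exact Finset.sum_congr rfl fun j _ => by simp [sq]
  rw [hsq, mul_pow]
  calc ∑ j ∈ Finset.range J, (w j * inner ℝ (e (g j)) x) ^ 2
      ≤ ∑ j ∈ Finset.range J, C ^ 2 * ‖inner ℝ (e (g j)) x‖ ^ 2 := by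
        refine Finset.sum_le_sum fun j _ => ?_
        rw [mul_pow, Real.norm_eq_abs, sq_abs]
        exact mul_le_mul_of_nonneg_right (sq_le_sq' (neg_le_of_abs_le (hw j)) (le_of_abs_le (hw j)))
          (sq_nonneg _)
    _ ≤ C ^ 2 * ‖x‖ ^ 2 := by
        rw [← Finset.mul_sum]
        exact mul_le_mul_of_nonneg_left ((he.comp g hg).sum_inner_products_le x) (sq_nonneg _)

end WeightedShift

/-! ### Matrix form of operators diagonal on the system. -/

section Diagonal

variable {H : Type*} [NormedAddCommGroup H] [InnerProductSpace ℝ H]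

/-- An operator with finitely many nonzero eigenvalues `κ` on the pentadiagonal system, written as a
sum of weighted shifts of the orthonormal sequence `e`. -/
noncomputable def pentaShift (e : ℕ → H) (a b c d κ : ℕ → ℝ) (J : ℕ) : H →L[ℝ] H :=
  weightedShift e (4 * J) κ id id
  + weightedShift e J (fun j => a (2 * j) * (κ (4 * j) - κ (4 * j + 1)))
      (fun j => 4 * j) (fun j => 4 * j + 1)
  + weightedShift e J (fun j => b (2 * j) * (κ (4 * j + 1) - κ (4 * j + 2)))
      (fun j => 4 * j + 1) (fun j => 4 * j + 2)
  + weightedShift e J (fun j => c (2 * j) * (κ (4 * j) - κ (4 * j + 1))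
        - d (2 * j) * (κ (4 * j + 1) - κ (4 * j + 2)))
      (fun j => 4 * j) (fun j => 4 * j + 2)
  + weightedShift e J (fun j => a (2 * j + 1) * (κ (4 * j + 2) - κ (4 * j + 3)))
      (fun j => 4 * j + 3) (fun j => 4 * j + 2)
  + weightedShift e J (fun j => b (2 * j + 1) * (κ (4 * j + 3) - κ (4 * (j + 1))))
      (fun j => 4 * (j + 1)) (fun j => 4 * j + 3)
  + weightedShift e J (fun j => c (2 * j + 1) * (κ (4 * j + 2) - κ (4 * j + 3))
        - d (2 * j + 1) * (κ (4 * j + 3) - κ (4 * (j + 1))))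
      (fun j => 4 * (j + 1)) (fun j => 4 * j + 2)

variable {e : ℕ → H} {a b c d κ : ℕ → ℝ} {J : ℕ}

theorem pentaShift_apply (he : Orthonormal ℝ e) (hcd : ∀ n, c n + d n = a n * b n)
    (hκ : ∀ n, 4 * J ≤ n → κ n = 0) (n : ℕ) :
    pentaShift e a b c d κ J (pentaSystem e a b c d n) = κ n • pentaSystem e a b c d n := by
  have inj : ∀ r, Function.Injective fun j : ℕ => 4 * j + r := fun r i j hij => by
    simpa using hij
  have hd : ∀ n, weightedShift e (4 * J) κ id id (e n) = κ n • e n := fun n =>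
    weightedShift_apply_self he Function.injective_id hκ n
  have hs : ∀ (w : ℕ → ℝ) (h : ℕ → ℕ) (r j : ℕ), (∀ j, J ≤ j → w j = 0) →
      weightedShift e J w h (fun j => 4 * j + r) (e (4 * j + r)) = w j • e (h j) :=
    fun w h r j hw => weightedShift_apply_self he (inj r) hw j
  have hs0 : ∀ (w : ℕ → ℝ) (h : ℕ → ℕ) (r m : ℕ), (∀ j, 4 * j + r ≠ m) →
      weightedShift e J w h (fun j => 4 * j + r) (e m) = 0 :=
    fun w h r m hm => weightedShift_apply_of_ne he hm
  -- `e0` to `e3` are the columns of the matrix; the cutoff `J` is invisible since all weights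
  -- beyond it vanish.
  have e0 : ∀ j, pentaShift e a b c d κ J (e (4 * j)) = κ (4 * j) • e (4 * j) := fun j => by
    simp only [pentaShift, add_apply, hd]
    repeat rw [hs0 _ _ _ _ (by intros; omega)]
    simp
  have e1 : ∀ j, pentaShift e a b c d κ J (e (4 * j + 1)) = κ (4 * j + 1) • e (4 * j + 1)
      + (a (2 * j) * (κ (4 * j) - κ (4 * j + 1))) • e (4 * j) := fun j => by
    simp only [pentaShift, add_apply, hd]
    rw [hs _ _ 1 _ (by intro i hi; simp [hκ (4 * i) (by omega), hκ (4 * i + 1) (by omega)])]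
    repeat rw [hs0 _ _ _ _ (by intros; omega)]
    simp
  have e3 : ∀ j, pentaShift e a b c d κ J (e (4 * j + 3)) = κ (4 * j + 3) • e (4 * j + 3)
      + (b (2 * j + 1) * (κ (4 * j + 3) - κ (4 * (j + 1)))) • e (4 * (j + 1)) := fun j => by
    simp only [pentaShift, add_apply, hd]
    rw [hs _ _ 3 _ (by
      intro i hi; simp [hκ (4 * i + 3) (by omega), hκ (4 * (i + 1)) (by omega)])]
    repeat rw [hs0 _ _ _ _ (by intros; omega)]
    simp
  have e2 : ∀ j, pentaShift e a b c d κ J (e (4 * j + 2)) = κ (4 * j + 2) • e (4 * j + 2)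
      + (b (2 * j) * (κ (4 * j + 1) - κ (4 * j + 2))) • e (4 * j + 1)
      + (c (2 * j) * (κ (4 * j) - κ (4 * j + 1))
        - d (2 * j) * (κ (4 * j + 1) - κ (4 * j + 2))) • e (4 * j)
      + (a (2 * j + 1) * (κ (4 * j + 2) - κ (4 * j + 3))) • e (4 * j + 3)
      + (c (2 * j + 1) * (κ (4 * j + 2) - κ (4 * j + 3))
        - d (2 * j + 1) * (κ (4 * j + 3) - κ (4 * (j + 1)))) • e (4 * (j + 1)) := fun j => by
    simp only [pentaShift, add_apply, hd]
    have hz : ∀ i, J ≤ i → ∀ r, κ (4 * i + r) = 0 := fun i hi r => hκ _ (by omega)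
    have hz0 : ∀ i, J ≤ i → κ (4 * i) = 0 := fun i hi => hκ _ (by omega)
    have hz4 : ∀ i, J ≤ i → κ (4 * (i + 1)) = 0 := fun i hi => hκ _ (by omega)
    rw [hs _ _ 2 _ (by intro i hi; simp [hz i hi]),
      hs _ _ 2 _ (by intro i hi; simp [hz i hi, hz0 i hi]),
      hs _ _ 2 _ (by intro i hi; simp [hz i hi]),
      hs _ _ 2 _ (by intro i hi; simp [hz i hi, hz4 i hi])]
    repeat rw [hs0 _ _ _ _ (by intros; omega)]
    simp
  induction n using forall_nat_mod_four with
  | h0 j => rw [pentaSystem_zero, e0]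
  | h1 j =>
    rw [pentaSystem_one, map_add, map_smul, e0, e1]
    module
  | h2 j =>
    have hd' : ∀ n, d n = a n * b n - c n := fun n => by linarith [hcd n]
    simp only [pentaSystem_two, map_add, map_sub, map_smul, e0, e1, e2, e3, hd']
    module
  | h3 j =>
    rw [pentaSystem_three, map_add, map_smul, e3, e0]
    module

theorem norm_pentaShift_le (he : Orthonormal ℝ e) {ε : ℝ} (hε : 0 ≤ ε)
    (hκ : ∀ n, |κ n| ≤ 1 + ε)
    (ha : ∀ n, |a n * (κ (2 * n) - κ (2 * n + 1))| ≤ ε)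
    (hb : ∀ n, |b n * (κ (2 * n + 1) - κ (2 * (n + 1)))| ≤ ε)
    (hc : ∀ n, |c n * (κ (2 * n) - κ (2 * n + 1))
      - d n * (κ (2 * n + 1) - κ (2 * (n + 1)))| ≤ ε) :
    ‖pentaShift e a b c d κ J‖ ≤ 1 + 7 * ε := by
  have inj : ∀ r, Function.Injective fun j : ℕ => 4 * j + r := fun r i j hij => by
    simpa using hij
  have i0 : Function.Injective fun j : ℕ => 4 * j := inj 0
  have i4 : Function.Injective fun j : ℕ => 4 * (j + 1) := inj 4
  have q0 : ∀ j, 2 * (2 * j) = 4 * j := fun j => by ring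
  have q1 : ∀ j, 2 * (2 * j + 1) = 4 * j + 2 := fun j => by ring
  have q2 : ∀ j, 2 * (2 * j + 1 + 1) = 4 * (j + 1) := fun j => by ring
  have n1 := norm_weightedShift_le (J := 4 * J) he Function.injective_id Function.injective_id
    (by positivity) hκ
  have n2 := norm_weightedShift_le (J := J) he (inj 1) i0 hε fun j => q0 j ▸ ha (2 * j)
  have n3 := norm_weightedShift_le (J := J) he (inj 2) (inj 1) hε fun j =>
    q1 j ▸ q0 j ▸ hb (2 * j)
  have n4 := norm_weightedShift_le (J := J) he (inj 2) i0 hε fun j => q1 j ▸ q0 j ▸ hc (2 * j)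
  have n5 := norm_weightedShift_le (J := J) he (inj 2) (inj 3) hε fun j =>
    q1 j ▸ ha (2 * j + 1)
  have n6 := norm_weightedShift_le (J := J) he (inj 3) i4 hε fun j =>
    q2 j ▸ q1 j ▸ hb (2 * j + 1)
  have n7 := norm_weightedShift_le (J := J) he (inj 2) i4 hε fun j =>
    q2 j ▸ q1 j ▸ hc (2 * j + 1)
  rw [pentaShift]
  refine (norm_add_le_of_le (norm_add_le_of_le (norm_add_le_of_le (norm_add_le_of_le
    (norm_add_le_of_le (norm_add_le_of_le n1 n2) n3) n4) n5) n6) n7).trans ?_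
  linarith

end Diagonal

/-! ### Slowly decreasing eigenvalues. -/

section Eigenvalues

/-- If `|b| ≤ 1` or `|a| ≤ 1`, the whole drop is put on `Y` or on `X`. Otherwise `X : Y = d : c`
makes `c X - d Y` vanish. The term `1/|a| + 1/|b|` of `mu` need not enter: `c + d = a b` with `hc`,
`hd` already gives `m |a b| ≤ 2 + |a| + |b|`. -/
theorem exists_step {a b c d m : ℝ} (hcd : c + d = a * b) (hm0 : 0 ≤ m) (hm1 : m ≤ 1)
    (hc : m * |c| ≤ 1 + |a|) (hd : m * |d| ≤ 1 + |b|) :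
    ∃ X Y : ℝ, X + Y = m / 2 ∧ |X| ≤ 1 ∧ |a * X| ≤ 1 ∧ |b * Y| ≤ 1 ∧ |c * X - d * Y| ≤ 1 := by
  rcases le_or_gt |b| 1 with hb | hb
  · refine ⟨0, m / 2, by ring, by simp, by simp, ?_, ?_⟩
    · rw [abs_mul, abs_of_nonneg (by linarith : 0 ≤ m / 2)]
      nlinarith [abs_nonneg b]
    · rw [mul_zero, zero_sub, abs_neg, abs_mul, abs_of_nonneg (by linarith : 0 ≤ m / 2)]
      linarith
  rcases le_or_gt |a| 1 with ha | ha
  · refine ⟨m / 2, 0, by ring, ?_, ?_, by simp, ?_⟩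
    · rw [abs_of_nonneg (by linarith : 0 ≤ m / 2)]
      linarith
    · rw [abs_mul, abs_of_nonneg (by linarith : 0 ≤ m / 2)]
      nlinarith [abs_nonneg a]
    · rw [mul_zero, sub_zero, abs_mul, abs_of_nonneg (by linarith : 0 ≤ m / 2)]
      linarith
  have ha0 : a ≠ 0 := by
    rintro rfl
    norm_num at ha
  have hb0 : b ≠ 0 := by
    rintro rfl
    norm_num at hb
  have hX : |a * (m / 2 * d / (a * b))| ≤ 1 := by
    have : a * (m / 2 * d / (a * b)) = m / 2 * d / b := by field_simp
    rw [this, abs_div, abs_mul, abs_of_nonneg (by linarith : 0 ≤ m / 2),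
      div_le_one (by linarith)]
    linarith
  have hY : |b * (m / 2 * c / (a * b))| ≤ 1 := by
    have : b * (m / 2 * c / (a * b)) = m / 2 * c / a := by field_simp
    rw [this, abs_div, abs_mul, abs_of_nonneg (by linarith : 0 ≤ m / 2),
      div_le_one (by linarith)]
    linarith
  refine ⟨m / 2 * d / (a * b), m / 2 * c / (a * b), ?_, ?_, hX, hY, ?_⟩
  · rw [← add_div, ← mul_add, add_comm d, hcd]
    field_simp
  · rw [abs_mul] at hX
    nlinarith [abs_nonneg (m / 2 * d / (a * b))]
  · have : c * (m / 2 * d / (a * b)) - d * (m / 2 * c / (a * b)) = 0 := by ring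
    simp [this]

/-- If the truncations were summable they would eventually be below 1, hence equal to `μ` on a tail,
which would have finite sum. -/
theorem not_summable_of_notEllOne {μ : ℕ → ℝ≥0∞} (hμ : NotEllOne μ) :
    ¬ Summable fun n => (min (μ n) 1).toReal := by
  intro hs
  have h1 : ∀ᶠ n in atTop, (min (μ n) 1).toReal < 1 :=
    hs.tendsto_atTop_zero.eventually (gt_mem_nhds one_pos)
  obtain ⟨N, hN⟩ := eventually_atTop.1 h1
  have h2 : ∀ n, μ (N + n) = ENNReal.ofReal (min (μ (N + n)) 1).toReal := by
    intro n
    have hlt := hN (N + n) (by omega)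
    rw [ENNReal.ofReal_toReal (by simp)]
    rcases le_total (μ (N + n)) 1 with hle | hle
    · rw [min_eq_left hle]
    · rw [min_eq_right hle] at hlt
      simp at hlt
  have h3 := hμ N
  rw [tsum_congr h2, ← ENNReal.ofReal_tsum_of_nonneg (fun n => ENNReal.toReal_nonneg)
    (by simpa only [add_comm] using (summable_nat_add_iff N).2 hs)] at h3
  exact ENNReal.ofReal_ne_top h3

theorem exists_sum_Ico_ge {m : ℕ → ℝ} (hm : ∀ n, 0 ≤ m n) (hs : ¬ Summable m) (N : ℕ) (C : ℝ) :
    ∃ K, N ≤ K ∧ C ≤ ∑ i ∈ Finset.Ico N K, m i := by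
  have ht := (not_summable_iff_tendsto_nat_atTop_of_nonneg hm).1 hs
  obtain ⟨K, hK, hNK⟩ := ((ht.eventually_ge_atTop (C + ∑ i ∈ Finset.range N, m i)).and
    (eventually_ge_atTop N)).exists
  refine ⟨K, hNK, ?_⟩
  rw [Finset.sum_Ico_eq_sub _ hNK]
  linarith

variable {a b c d : ℕ → ℝ}

theorem exists_step_of_mu (hcd : ∀ n, c n + d n = a n * b n) (n : ℕ) :
    ∃ X Y : ℝ, X + Y = (min (mu a b c d n) 1).toReal / 2 ∧ |X| ≤ 1 ∧ |a n * X| ≤ 1 ∧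
      |b n * Y| ≤ 1 ∧ |c n * X - d n * Y| ≤ 1 := by
  have hfin : min (mu a b c d n) 1 ≠ ∞ := by simp
  have key : ∀ u v : ℝ, min (mu a b c d n) 1 ≤ (1 + ENNReal.ofReal |u|) / ENNReal.ofReal |v| →
      (min (mu a b c d n) 1).toReal * |v| ≤ 1 + |u| := by
    intro u v h
    have h1 : min (mu a b c d n) 1 * ENNReal.ofReal |v| ≤ 1 + ENNReal.ofReal |u| :=
      ENNReal.mul_le_of_le_div h
    have h2 := ENNReal.toReal_mono (by simp) h1
    rwa [ENNReal.toReal_mul, ENNReal.toReal_ofReal (abs_nonneg _),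
      ENNReal.toReal_add (by simp) (by simp), ENNReal.toReal_ofReal (abs_nonneg _),
      ENNReal.toReal_one] at h2
  refine exists_step (hcd n) ENNReal.toReal_nonneg ?_ (key _ _ ?_) (key _ _ ?_)
  · exact ENNReal.toReal_le_of_le_ofReal zero_le_one (by simp)
  · exact (min_le_left _ _).trans ((min_le_right _ _).trans (min_le_right _ _))
  · exact (min_le_left _ _).trans ((min_le_right _ _).trans (min_le_left _ _))

/-- If `mu` is not summable then there are finitely supported eigenvalues, equal to `1` on a long
initial segment, that decrease so slowly that all off-diagonal entries are small. -/
theorem exists_eigenvalues (hcd : ∀ n, c n + d n = a n * b n) (hμ : NotEllOne (mu a b c d))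
    (N : ℕ) {ε : ℝ} (hε : 0 < ε) :
    ∃ (κ : ℕ → ℝ) (J : ℕ), (∀ n, n < 4 * N → κ n = 1) ∧ (∀ n, 4 * J ≤ n → κ n = 0) ∧
      (∀ n, |κ n| ≤ 1 + ε) ∧
      (∀ n, |a n * (κ (2 * n) - κ (2 * n + 1))| ≤ ε) ∧
      (∀ n, |b n * (κ (2 * n + 1) - κ (2 * (n + 1)))| ≤ ε) ∧
      (∀ n, |c n * (κ (2 * n) - κ (2 * n + 1))
        - d n * (κ (2 * n + 1) - κ (2 * (n + 1)))| ≤ ε) := by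
  choose X Y hXY hX haX hbY hcX using exists_step_of_mu (a := a) (b := b) (c := c) (d := d) hcd
  -- The bound `2 / ε` offsets the factor `1 / 2` in `X + Y`, so that steps scaled by `ε` drop by at
  -- least 1 in total.
  obtain ⟨K, hNK, hK⟩ := exists_sum_Ico_ge (m := fun n => (min (mu a b c d n) 1).toReal)
    (fun n => ENNReal.toReal_nonneg) (not_summable_of_notEllOne hμ) (2 * N) (2 / ε)
  set I := Finset.Ico (2 * N) K with hI
  set S := ∑ i ∈ I, ε * (X i + Y i) with hS
  have ht0 : ∀ i, 0 ≤ X i + Y i := fun i => by rw [hXY]; positivity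
  have hS1 : 1 ≤ S := by
    rw [hS, ← Finset.mul_sum, Finset.sum_congr rfl fun i _ => hXY i, ← Finset.sum_div]
    rw [div_le_iff₀ hε] at hK
    linarith
  have hS0 : 0 < S := by linarith
  -- Rescaling makes the total drop exactly 1 and keeps the scale at most `ε`.
  set δ := ε / S with hδ
  have hδ0 : 0 ≤ δ := by positivity
  have hδε : δ ≤ ε := div_le_self hε.le hS1
  set x : ℕ → ℝ := fun i => if i ∈ I then δ * X i else 0 with hx
  set y : ℕ → ℝ := fun i => if i ∈ I then δ * Y i else 0 with hy
  set s : ℕ → ℝ := fun n => 1 - ∑ i ∈ Finset.range n, (x i + y i) with hs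
  have hxy : ∀ i, x i + y i = if i ∈ I then δ * (X i + Y i) else 0 := fun i => by
    simp only [hx, hy]
    split_ifs <;> ring
  have hsum : ∀ n, ∑ i ∈ Finset.range n, (x i + y i) =
      ∑ i ∈ Finset.range n ∩ I, δ * (X i + Y i) := fun n => by
    rw [Finset.sum_congr rfl fun i _ => hxy i, Finset.sum_ite_mem]
  have htot : ∑ i ∈ I, δ * (X i + Y i) = 1 := by
    have : ∀ i ∈ I, δ * (X i + Y i) = (ε * (X i + Y i)) / S := fun i _ => by rw [hδ]; ring
    rw [Finset.sum_congr rfl this, ← Finset.sum_div, ← hS, div_self hS0.ne']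
  have hs1 : ∀ n, s n ≤ 1 := fun n => by
    have : 0 ≤ ∑ i ∈ Finset.range n ∩ I, δ * (X i + Y i) :=
      Finset.sum_nonneg fun i _ => mul_nonneg hδ0 (ht0 i)
    simp only [hs, hsum]
    linarith
  have hs0 : ∀ n, 0 ≤ s n := fun n => by
    have : ∑ i ∈ Finset.range n ∩ I, δ * (X i + Y i) ≤ ∑ i ∈ I, δ * (X i + Y i) :=
      Finset.sum_le_sum_of_subset_of_nonneg Finset.inter_subset_right
        fun i _ _ => mul_nonneg hδ0 (ht0 i)
    simp only [hs, hsum]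
    linarith
  have hbd : ∀ (p : Prop) [Decidable p] (u : ℝ), |u| ≤ 1 → |if p then δ * u else 0| ≤ ε := by
    intro p _ u hu
    split_ifs
    · rw [abs_mul, abs_of_nonneg hδ0]
      nlinarith [abs_nonneg u]
    · simpa using hε.le
  -- Even indices carry `s`, which stays in `[0, 1]`. Since `x` may have either sign, odd values can
  -- leave this interval by up to `ε`.
  set κ : ℕ → ℝ := fun m => s (m / 2) - if m % 2 = 1 then x (m / 2) else 0 with hκ
  have hκ0 : ∀ n, κ (2 * n) = s n := fun n => by
    have h1 : 2 * n / 2 = n := by omega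
    simp [hκ, h1]
  have hκ1 : ∀ n, κ (2 * n + 1) = s n - x n := fun n => by
    have h1 : (2 * n + 1) / 2 = n := by omega
    have h2 : (2 * n + 1) % 2 = 1 := by omega
    simp only [hκ, h1, h2, if_true]
  have hd0 : ∀ n, κ (2 * n) - κ (2 * n + 1) = x n := fun n => by rw [hκ0, hκ1]; ring
  have hd1 : ∀ n, κ (2 * n + 1) - κ (2 * (n + 1)) = y n := fun n => by
    rw [hκ0, hκ1]
    simp only [hs, Finset.sum_range_succ]
    ring
  refine ⟨κ, K, ?_, ?_, ?_, ?_, ?_, ?_⟩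
  · intro m hm
    have hdisj : Finset.range (m / 2) ∩ I = ∅ := by
      refine Finset.eq_empty_of_forall_notMem fun i h => ?_
      simp only [Finset.mem_inter, Finset.mem_range, hI, Finset.mem_Ico] at h
      omega
    have hxm : x (m / 2) = 0 := by
      simp only [hx]
      rw [if_neg]
      simp only [hI, Finset.mem_Ico]
      omega
    simp only [hκ, hxm, hs, hsum, hdisj]
    simp
  · intro m hm
    have hsub : Finset.range (m / 2) ∩ I = I := by
      refine Finset.inter_eq_right.2 fun i hi => ?_
      simp only [Finset.mem_range]
      simp only [hI, Finset.mem_Ico] at hi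
      omega
    have hxm : x (m / 2) = 0 := by
      simp only [hx]
      rw [if_neg]
      simp only [hI, Finset.mem_Ico]
      omega
    simp only [hκ, hxm, hs, hsum, hsub, htot]
    simp
  · intro m
    have h1 := abs_le.1 (hbd (m / 2 ∈ I) _ (hX (m / 2)))
    have h2 := hs0 (m / 2)
    have h3 := hs1 (m / 2)
    simp only [hκ]
    rw [abs_le]
    split_ifs
    · simp only [hx]
      constructor <;> linarith
    · constructor <;> linarith
  · intro n
    rw [hd0]
    simp only [hx, mul_ite, mul_zero]
    rw [mul_left_comm]
    exact hbd _ _ (haX n)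
  · intro n
    rw [hd1]
    simp only [hy, mul_ite, mul_zero]
    rw [mul_left_comm]
    exact hbd _ _ (hbY n)
  · intro n
    rw [hd0, hd1]
    have : c n * x n - d n * y n = if n ∈ I then δ * (c n * X n - d n * Y n) else 0 := by
      simp only [hx, hy]
      split_ifs <;> ring
    rw [this]
    exact hbd _ _ (hcX n)

end Eigenvalues

/-! ### Strong approximation: divergence implies rank one density. -/

section Density

variable {H : Type*} [NormedAddCommGroup H] [InnerProductSpace ℝ H]

/-- Uniformly bounded operators that eventually fix each member of a total sequence converge
strongly to the identity. -/
theorem tendsto_apply_of_eventually_fixed {f : ℕ → H}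
    (hf : Dense (Submodule.span ℝ (Set.range f) : Set H)) {K : ℕ → H →L[ℝ] H} {C : ℝ}
    (hC : ∀ i, ‖K i‖ ≤ C) (hK : ∀ n, ∀ᶠ i in atTop, K i (f n) = f n) (x : H) :
    Tendsto (fun i => K i x) atTop (𝓝 x) := by
  have hspan : ∀ y ∈ Submodule.span ℝ (Set.range f), ∀ᶠ i in atTop, K i y = y := by
    intro y hy
    induction hy using Submodule.span_induction with
    | mem y hy => obtain ⟨n, rfl⟩ := hy; exact hK n
    | zero => simp
    | add y z _ _ hy hz => filter_upwards [hy, hz] with i h1 h2; rw [map_add, h1, h2]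
    | smul r y _ hy => filter_upwards [hy] with i h1; rw [map_smul, h1]
  have hC0 : 0 ≤ C := (norm_nonneg _).trans (hC 0)
  rw [Metric.tendsto_nhds]
  intro ε hε
  obtain ⟨y, hy, hxy⟩ := Metric.dense_iff.1 hf x (ε / (C + 1)) (by positivity)
  rw [Metric.mem_ball, dist_comm, dist_eq_norm, lt_div_iff₀ (by positivity)] at hy
  filter_upwards [hspan y hxy] with i hi
  rw [dist_eq_norm]
  calc ‖K i x - x‖ = ‖K i (x - y) - (x - y)‖ := by rw [map_sub, hi]; congr 1; abel
    _ ≤ ‖K i (x - y)‖ + ‖x - y‖ := norm_sub_le _ _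
    _ ≤ C * ‖x - y‖ + ‖x - y‖ := by
        gcongr
        exact (K i).le_of_opNorm_le (hC i) _
    _ = ‖x - y‖ * (C + 1) := by ring
    _ < ε := hy

/-- Finitely many approximation conditions at the identity form an open set for pointwise
convergence. -/
theorem RankOneDense.kPointDense {f : ℕ → H} (hf : RankOneDense f) (k : ℕ) : KPointDense f k := by
  intro x ε hε
  have h1 := hf 1 (one_mem _) ContinuousLinearMap.norm_id_le
  have hopen : IsOpen {S : H →Lₚₜ[ℝ] H | ∀ s : Fin k, ‖S (x s) - x s‖ < ε} := by
    simp only [Set.ofPred_forall]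
    refine isOpen_iInter_of_finite fun s => ?_
    exact isOpen_lt (((PointwiseConvergenceCLM.evalCLM (RingHom.id ℝ) (𝕜₂ := ℝ) H
      (x s)).continuous.sub continuous_const).norm) continuous_const
  obtain ⟨_, hS, S, ⟨hS1, -⟩, rfl⟩ := mem_closure_iff.1 h1 _ hopen (by
    intro s
    change ‖x s - x s‖ < ε
    simpa using hε)
  exact ⟨S, hS1, hS⟩

variable {a b c d : ℕ → ℝ}

theorem rankOneDense_of_notEllOne (e : HilbertBasis ℕ ℝ H)
    (hcd : ∀ n, c n + d n = a n * b n) (hμ : NotEllOne (mu a b c d)) :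
    RankOneDense (pentaSystem e a b c d) := by
  intro T hT hT1
  have hb := isBiorthogonalBasis_pentaSystem e hcd
  choose l hl using hT
  set ε : ℕ → ℝ := fun i => 1 / ((i : ℝ) + 1) with hεdef
  have hε : ∀ i, 0 < ε i := fun i => by positivity
  choose κ J h1 h0 hκ ha hb' hc using fun i => exists_eigenvalues hcd hμ i (hε i)
  set K : ℕ → H →L[ℝ] H := fun i => pentaShift e a b c d (κ i) (J i)
  have hKf : ∀ i n, K i (pentaSystem e a b c d n) = κ i n • pentaSystem e a b c d n := fun i =>
    pentaShift_apply e.orthonormal hcd (h0 i)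
  have hKn : ∀ i, ‖K i‖ ≤ 1 + 7 * ε i := fun i =>
    norm_pentaShift_le e.orthonormal (hε i).le (hκ i) (ha i) (hb' i) (hc i)
  have hε1 : ∀ i, ε i ≤ 1 := fun i => by
    rw [hεdef]
    exact div_le_one_of_le₀ (by linarith [(Nat.cast_nonneg i : (0 : ℝ) ≤ i)]) (by positivity)
  have hKx : ∀ x, Tendsto (fun i => K i x) atTop (𝓝 x) :=
    tendsto_apply_of_eventually_fixed hb.dense_span (C := 8)
      (fun i => (hKn i).trans (by linarith [hε1 i])) fun n => by
        filter_upwards [eventually_gt_atTop n] with i hi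
        rw [hKf, h1 i n (by omega), one_smul]
  -- The scalar brings the product into the unit ball and tends to 1.
  set S : ℕ → H →L[ℝ] H := fun i => (1 + 7 * ε i)⁻¹ • (T * K i) with hSdef
  have hSmem : ∀ i, S i ∈ rankOneAlgebra (pentaSystem e a b c d) := fun i => by
    refine SMulMemClass.smul_mem _ (hb.mem_rankOneAlgebra_of_eventually_zero
      (l := fun n => κ i n * l n) (N := 4 * J i) (fun n => ?_) fun n hn => ?_)
    · rw [mul_apply_eq_comp, hKf, map_smul, hl, smul_smul]
    · simp [h0 i n hn]
  have hSn : ∀ i, ‖S i‖ ≤ 1 := fun i => by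
    have hpos : 0 < 1 + 7 * ε i := by linarith [hε i]
    rw [hSdef, norm_smul, norm_inv, Real.norm_of_nonneg hpos.le, inv_mul_le_one₀ hpos]
    calc ‖T * K i‖ ≤ ‖T‖ * ‖K i‖ := norm_mul_le _ _
      _ ≤ 1 * (1 + 7 * ε i) := by gcongr; exact hKn i
      _ = 1 + 7 * ε i := one_mul _
  have hε0 : Tendsto ε atTop (𝓝 0) := tendsto_one_div_add_atTop_nhds_zero_nat
  have hlim : Tendsto (fun i => (1 + 7 * ε i)⁻¹) atTop (𝓝 1) := by
    have := ((hε0.const_mul 7).const_add 1).inv₀ (by norm_num)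
    simpa using this
  refine mem_closure_of_tendsto (b := atTop)
    (f := fun i => ContinuousLinearMap.toPointwiseConvergenceCLM ℝ (RingHom.id ℝ) H H (S i))
    ?_ (Eventually.of_forall fun i => ⟨S i, ⟨hSmem i, hSn i⟩, rfl⟩)
  rw [PointwiseConvergenceCLM.tendsto_iff_forall_tendsto]
  intro x
  have := hlim.smul ((T.continuous.tendsto x).comp (hKx x))
  rw [one_smul] at this
  exact this

end Density

/-! ### Weights and planar vectors for the annihilating functional. -/

section Weights

/-- Two linear equations in three unknowns: setting `δ`, `γ` or `α` to zero gives a solution whose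
size is the first, second or third term of the minimum. The vanishing product is what rank two will
require. -/
theorem exists_weights_of_mu {a b c d : ℕ → ℝ} {n : ℕ} (hcd : c n + d n = a n * b n)
    (hfin : mu a b c d n ≠ ∞) :
    ∃ α γ δ : ℝ, α * a n + δ * c n = -1 ∧ γ * b n - δ * d n = -1 ∧ α * γ * δ = 0 ∧
      |α| + |γ| + |δ| ≤ (mu a b c d n).toReal := by
  have hne : ∀ (t : ℝ) (p : ℝ≥0∞), p ≠ 0 → p / ENNReal.ofReal |t| ≠ ∞ → t ≠ 0 := by
    rintro t p hp h rfl
    simp [ENNReal.div_zero hp] at h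
  have hdiv : ∀ u v : ℝ, ((1 + ENNReal.ofReal |u|) / ENNReal.ofReal |v|).toReal =
      (1 + |u|) / |v| := fun u v => by
    rw [ENNReal.toReal_div, ENNReal.toReal_add (by simp) (by simp),
      ENNReal.toReal_ofReal (abs_nonneg _), ENNReal.toReal_ofReal (abs_nonneg _),
      ENNReal.toReal_one]
  rcases min_choice (1 / ENNReal.ofReal |a n| + 1 / ENNReal.ofReal |b n|)
    (min ((1 + ENNReal.ofReal |b n|) / ENNReal.ofReal |d n|)
      ((1 + ENNReal.ofReal |a n|) / ENNReal.ofReal |c n|)) with h | h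
  · have hmu : mu a b c d n = _ := h
    rw [hmu, ENNReal.add_ne_top] at hfin
    have ha := hne _ _ one_ne_zero hfin.1
    have hb := hne _ _ one_ne_zero hfin.2
    refine ⟨-1 / a n, -1 / b n, 0, by field_simp; ring, by field_simp; ring, by ring, ?_⟩
    rw [hmu, ENNReal.toReal_add hfin.1 hfin.2, ENNReal.toReal_div, ENNReal.toReal_div,
      ENNReal.toReal_ofReal (abs_nonneg _), ENNReal.toReal_ofReal (abs_nonneg _),
      ENNReal.toReal_one, abs_div, abs_div, abs_neg, abs_one, abs_zero, add_zero]
  · have h1p : ∀ t : ℝ, 1 + ENNReal.ofReal |t| ≠ 0 := fun t => by simp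
    rcases min_choice ((1 + ENNReal.ofReal |b n|) / ENNReal.ofReal |d n|)
      ((1 + ENNReal.ofReal |a n|) / ENNReal.ofReal |c n|) with h' | h'
    · have hmu : mu a b c d n = _ := h.trans h'
      rw [hmu] at hfin
      have hd := hne _ _ (h1p _) hfin
      refine ⟨-b n / d n, 0, 1 / d n, ?_, ?_, by ring, ?_⟩
      · field_simp
        linarith
      · field_simp
        ring
      · rw [hmu, hdiv, abs_div, abs_div, abs_neg, abs_one, abs_zero, ← sub_nonneg]
        apply le_of_eq
        ring
    · have hmu : mu a b c d n = _ := h.trans h'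
      rw [hmu] at hfin
      have hc := hne _ _ (h1p _) hfin
      refine ⟨0, -a n / c n, -1 / c n, ?_, ?_, by ring, ?_⟩
      · field_simp
        ring
      · field_simp
        linarith
      · rw [hmu, hdiv, abs_div, abs_div, abs_neg, abs_neg, abs_one, abs_zero, ← sub_nonneg]
        apply le_of_eq
        ring

theorem exists_weights {a b c d : ℕ → ℝ} (hcd : ∀ n, c n + d n = a n * b n)
    (hμ : ¬ NotEllOne (mu a b c d)) :
    ∃ (N : ℕ) (α γ δ : ℕ → ℝ), (∀ n, α n * a n + δ n * c n = if n < 2 * N then 0 else -1) ∧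
      (∀ n, γ n * b n - δ n * d n = if n < 2 * N then 0 else -1) ∧
      (∀ n, α n * γ n * δ n = 0) ∧ Summable fun n => |α n| + |γ n| + |δ n| := by
  obtain ⟨N, hN⟩ := not_forall.1 hμ
  have hfin := ENNReal.ne_top_of_tsum_ne_top hN
  have hsum := ENNReal.summable_toReal hN
  have hex : ∀ n, ∃ α γ δ : ℝ, α * a n + δ * c n = (if n < 2 * N then 0 else -1) ∧
      γ * b n - δ * d n = (if n < 2 * N then 0 else -1) ∧ α * γ * δ = 0 ∧
      |α| + |γ| + |δ| ≤ (mu a b c d n).toReal := by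
    intro n
    split_ifs with hn
    · exact ⟨0, 0, 0, by simp⟩
    · refine exists_weights_of_mu (hcd n) ?_
      have := hfin (n - N)
      rwa [show N + (n - N) = n by omega] at this
  choose α γ δ h1 h2 h3 h4 using hex
  refine ⟨N, α, γ, δ, h1, h2, h3, ?_⟩
  rw [← summable_nat_add_iff N]
  refine Summable.of_nonneg_of_le (fun n => by positivity) (fun n => ?_) hsum
  rw [add_comm N n]
  exact h4 _

/-- Polar coordinates of planar vectors `P n` of square summable lengths `ρ n` such that
consecutive ones have inner product `δ n`. -/
theorem exists_polar {α γ δ : ℕ → ℝ} (hs : Summable fun n => |α n| + |γ n| + |δ n|) :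
    ∃ ρ θ : ℕ → ℝ, (∀ n, 0 < ρ n) ∧ (Summable fun n => ρ n ^ 2) ∧
      (Summable fun n => (α n / ρ n) ^ 2) ∧ (Summable fun n => (γ n / ρ (n + 1)) ^ 2) ∧
      ∀ n, ρ n * ρ (n + 1) * Real.cos (θ (n + 1) - θ n) = δ n := by
  -- The geometric term keeps `τ`, and hence the lengths, positive.
  set τ : ℕ → ℝ := fun n => (1 / 2) ^ n + (|α n| + |γ n| + |δ n|) with hτ
  have hτs : Summable τ := summable_geometric_two.add hs
  have hτ0 : ∀ n, 0 < τ n := fun n => by positivity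
  have hατ : ∀ n, |α n| ≤ τ n ∧ |γ n| ≤ τ n ∧ |δ n| ≤ τ n := fun n => by
    have h1 : (0 : ℝ) < (1 / 2) ^ n := by positivity
    have h2 := abs_nonneg (α n)
    have h3 := abs_nonneg (γ n)
    have h4 := abs_nonneg (δ n)
    simp only [hτ]
    refine ⟨?_, ?_, ?_⟩ <;> linarith
  -- Both `ρ n ^ 2` and `ρ (n + 1) ^ 2` dominate `τ n`, so `δ n / (ρ n * ρ (n + 1))` is a cosine. At
  -- `n = 0` the second term is again `τ 0`, which is harmless.
  set ρ : ℕ → ℝ := fun n => √(τ n + τ (n - 1)) with hρ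
  have hρ0 : ∀ n, 0 < ρ n := fun n => Real.sqrt_pos.2 (add_pos (hτ0 _) (hτ0 _))
  have hρ2 : ∀ n, ρ n ^ 2 = τ n + τ (n - 1) := fun n =>
    Real.sq_sqrt (add_pos (hτ0 _) (hτ0 _)).le
  have hτρ : ∀ n, τ n ≤ ρ n ^ 2 := fun n => by rw [hρ2]; linarith [hτ0 (n - 1)]
  have hτρ' : ∀ n, τ n ≤ ρ (n + 1) ^ 2 := fun n => by
    rw [hρ2, Nat.add_sub_cancel]
    linarith [hτ0 (n + 1)]
  have hquot : ∀ {u t r : ℝ}, |u| ≤ t → 0 < t → t ≤ r ^ 2 → 0 < r → (u / r) ^ 2 ≤ t := by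
    intro u t r hu ht hr hr0
    rw [div_pow, div_le_iff₀ (by positivity), ← sq_abs]
    nlinarith [abs_nonneg u]
  have hδ : ∀ n, |δ n / (ρ n * ρ (n + 1))| ≤ 1 := fun n => by
    have hpos := mul_pos (hρ0 n) (hρ0 (n + 1))
    rw [abs_div, abs_of_pos hpos, div_le_one hpos]
    refine (hατ n).2.2.trans (abs_le_of_sq_le_sq' ?_ hpos.le).2
    rw [mul_pow, sq]
    exact mul_le_mul (hτρ n) (hτρ' n) (hτ0 n).le (sq_nonneg _)
  refine ⟨ρ, fun n => ∑ i ∈ Finset.range n, Real.arccos (δ i / (ρ i * ρ (i + 1))), hρ0, ?_, ?_,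
    ?_, ?_⟩
  · simp only [hρ2]
    refine hτs.add ((summable_nat_add_iff 1).1 ?_)
    simpa using hτs
  · exact Summable.of_nonneg_of_le (fun n => sq_nonneg _)
      (fun n => hquot (hατ n).1 (hτ0 n) (hτρ n) (hρ0 n)) hτs
  · exact Summable.of_nonneg_of_le (fun n => sq_nonneg _)
      (fun n => hquot (hατ n).2.1 (hτ0 n) (hτρ' n) (hρ0 _)) hτs
  · intro n
    beta_reduce
    rw [Finset.sum_range_succ, add_sub_cancel_left,
      Real.cos_arccos (abs_le.1 (hδ n)).1 (abs_le.1 (hδ n)).2]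
    field_simp [(hρ0 n).ne', (hρ0 (n + 1)).ne']

end Weights

/-! ### The rank two annihilator: density implies divergence. -/

section Annihilator

variable {H : Type*} [NormedAddCommGroup H] [InnerProductSpace ℝ H]

theorem summable_of_mod_four {f : ℕ → ℝ} (h0 : Summable fun j => f (4 * j))
    (h1 : Summable fun j => f (4 * j + 1)) (h2 : Summable fun j => f (4 * j + 2))
    (h3 : Summable fun j => f (4 * j + 3)) : Summable f := by
  have aux : ∀ g : ℕ → ℝ, Summable (fun j => g (2 * j)) → Summable (fun j => g (2 * j + 1)) →
      Summable g := fun g h h' => (h.hasSum.even_add_odd h'.hasSum).summable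
  have q0 : ∀ j, 2 * (2 * j) = 4 * j := fun j => by ring
  have q1 : ∀ j, 2 * (2 * j + 1) = 4 * j + 2 := fun j => by ring
  refine aux f (aux _ ?_ ?_) (aux _ ?_ ?_)
  · simpa only [q0] using h0
  · simpa only [q1] using h2
  · simpa only [q0] using h1
  · simpa only [q1] using h3

/-- Vectors with prescribed coordinates along the four residue classes modulo `4`. -/
theorem exists_coordinates [CompleteSpace H] (e : HilbertBasis ℕ ℝ H) {u₀ u₁ u₂ u₃ : ℕ → ℝ}
    (h0 : Summable fun j => u₀ j ^ 2) (h1 : Summable fun j => u₁ j ^ 2)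
    (h2 : Summable fun j => u₂ j ^ 2) (h3 : Summable fun j => u₃ j ^ 2) :
    ∃ x : H, (∀ j, inner ℝ (e (4 * j)) x = u₀ j) ∧ (∀ j, inner ℝ (e (4 * j + 1)) x = u₁ j) ∧
      (∀ j, inner ℝ (e (4 * j + 2)) x = u₂ j) ∧ ∀ j, inner ℝ (e (4 * j + 3)) x = u₃ j := by
  set v : ℕ → ℝ := fun m => match m % 4 with
    | 0 => u₀ (m / 4)
    | 1 => u₁ (m / 4)
    | 2 => u₂ (m / 4)
    | _ => u₃ (m / 4) with hv
  have v0 : ∀ j, v (4 * j) = u₀ j := fun j => by simp [hv]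
  have v1 : ∀ j, v (4 * j + 1) = u₁ j := fun j => by
    simp only [hv, show (4 * j + 1) % 4 = 1 by omega, show (4 * j + 1) / 4 = j by omega]
  have v2 : ∀ j, v (4 * j + 2) = u₂ j := fun j => by
    simp only [hv, show (4 * j + 2) % 4 = 2 by omega, show (4 * j + 2) / 4 = j by omega]
  have v3 : ∀ j, v (4 * j + 3) = u₃ j := fun j => by
    simp only [hv, show (4 * j + 3) % 4 = 3 by omega, show (4 * j + 3) / 4 = j by omega]
  have hsum : Summable fun m => v m ^ 2 :=
    summable_of_mod_four (by simpa only [v0] using h0) (by simpa only [v1] using h1)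
      (by simpa only [v2] using h2) (by simpa only [v3] using h3)
  have hmem : Memℓp v 2 := by
    rw [memℓp_gen_iff (by norm_num)]
    simpa using hsum
  have hx : ∀ m, inner ℝ (e m) (e.repr.symm ⟨v, hmem⟩) = v m := fun m => by
    rw [← e.repr_apply_apply, LinearIsometryEquiv.apply_symm_apply]
  exact ⟨e.repr.symm ⟨v, hmem⟩, fun j => (hx _).trans (v0 j), fun j => (hx _).trans (v1 j),
    fun j => (hx _).trans (v2 j), fun j => (hx _).trans (v3 j)⟩

theorem summable_sq_mul_of_abs_le_one {r t : ℕ → ℝ} (hr : Summable fun n => r n ^ 2)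
    (ht : ∀ n, |t n| ≤ 1) : Summable fun n => (r n * t n) ^ 2 := by
  refine Summable.of_nonneg_of_le (fun n => sq_nonneg _) (fun n => ?_) hr
  rw [mul_pow]
  exact mul_le_of_le_one_right (sq_nonneg _) ((sq_le_one_iff_abs_le_one _).2 (ht n))

/-- Pairs of vectors with prescribed planar coordinates, given in polar form, along the four residue
classes modulo `4`. -/
theorem exists_polar_coordinates [CompleteSpace H] (e : HilbertBasis ℕ ℝ H)
    {r₀ r₁ r₂ r₃ t₀ t₁ t₂ t₃ : ℕ → ℝ}
    (h0 : Summable fun j => r₀ j ^ 2) (h1 : Summable fun j => r₁ j ^ 2)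
    (h2 : Summable fun j => r₂ j ^ 2) (h3 : Summable fun j => r₃ j ^ 2) :
    ∃ x y : H,
      (∀ j, inner ℝ (e (4 * j)) x = r₀ j * Real.cos (t₀ j) ∧
        inner ℝ (e (4 * j)) y = r₀ j * Real.sin (t₀ j)) ∧
      (∀ j, inner ℝ (e (4 * j + 1)) x = r₁ j * Real.cos (t₁ j) ∧
        inner ℝ (e (4 * j + 1)) y = r₁ j * Real.sin (t₁ j)) ∧
      (∀ j, inner ℝ (e (4 * j + 2)) x = r₂ j * Real.cos (t₂ j) ∧
        inner ℝ (e (4 * j + 2)) y = r₂ j * Real.sin (t₂ j)) ∧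
      (∀ j, inner ℝ (e (4 * j + 3)) x = r₃ j * Real.cos (t₃ j) ∧
        inner ℝ (e (4 * j + 3)) y = r₃ j * Real.sin (t₃ j)) := by
  obtain ⟨x, x0, x1, x2, x3⟩ := exists_coordinates e
    (summable_sq_mul_of_abs_le_one h0 fun j => Real.abs_cos_le_one (t₀ j))
    (summable_sq_mul_of_abs_le_one h1 fun j => Real.abs_cos_le_one (t₁ j))
    (summable_sq_mul_of_abs_le_one h2 fun j => Real.abs_cos_le_one (t₂ j))
    (summable_sq_mul_of_abs_le_one h3 fun j => Real.abs_cos_le_one (t₃ j))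
  obtain ⟨y, y0, y1, y2, y3⟩ := exists_coordinates e
    (summable_sq_mul_of_abs_le_one h0 fun j => Real.abs_sin_le_one (t₀ j))
    (summable_sq_mul_of_abs_le_one h1 fun j => Real.abs_sin_le_one (t₁ j))
    (summable_sq_mul_of_abs_le_one h2 fun j => Real.abs_sin_le_one (t₂ j))
    (summable_sq_mul_of_abs_le_one h3 fun j => Real.abs_sin_le_one (t₃ j))
  exact ⟨x, y, fun j => ⟨x0 j, y0 j⟩, fun j => ⟨x1 j, y1 j⟩, fun j => ⟨x2 j, y2 j⟩,
    fun j => ⟨x3 j, y3 j⟩⟩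

/-- The bilinear form `(p, q) ↦ ⟪p, x⟫ ⟪q, u⟫ + ⟪p, y⟫ ⟪q, v⟫`, the entries of an operator of
rank at most two. -/
noncomputable def rankTwoForm (x y u v p q : H) : ℝ :=
  inner ℝ p x * inner ℝ q u + inner ℝ p y * inner ℝ q v

/-- Each value is a difference of right-hand sides of `ha` and `hb` at equal or adjacent indices.
These jump only at `2 * N`, where the diagonal entry 1 at `4 * N` compensates. -/
theorem rankTwoForm_eq_zero {e : ℕ → H} {a b c d α γ δ : ℕ → ℝ} {N : ℕ} {x y u v : H}
    (hcd : ∀ n, c n + d n = a n * b n)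
    (ha : ∀ n, α n * a n + δ n * c n = if n < 2 * N then 0 else -1)
    (hb : ∀ n, γ n * b n - δ n * d n = if n < 2 * N then 0 else -1)
    (h00 : ∀ j, rankTwoForm x y u v (e (4 * j)) (e (4 * j)) = if j = N then 1 else 0)
    (h11 : ∀ j, rankTwoForm x y u v (e (4 * j + 1)) (e (4 * j + 1)) = 0)
    (h22 : ∀ j, rankTwoForm x y u v (e (4 * j + 2)) (e (4 * j + 2)) = 0)
    (h33 : ∀ j, rankTwoForm x y u v (e (4 * j + 3)) (e (4 * j + 3)) = 0)
    (h10 : ∀ j, rankTwoForm x y u v (e (4 * j + 1)) (e (4 * j)) = α (2 * j))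
    (h21 : ∀ j, rankTwoForm x y u v (e (4 * j + 2)) (e (4 * j + 1)) = γ (2 * j))
    (h20 : ∀ j, rankTwoForm x y u v (e (4 * j + 2)) (e (4 * j)) = δ (2 * j))
    (h23 : ∀ j, rankTwoForm x y u v (e (4 * j + 2)) (e (4 * j + 3)) = α (2 * j + 1))
    (h34 : ∀ j, rankTwoForm x y u v (e (4 * j + 3)) (e (4 * (j + 1))) = γ (2 * j + 1))
    (h24 : ∀ j, rankTwoForm x y u v (e (4 * j + 2)) (e (4 * (j + 1))) = δ (2 * j + 1)) (n : ℕ) :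
    rankTwoForm x y u v (pentaDual e a b c d n) (pentaSystem e a b c d n) = 0 := by
  simp only [rankTwoForm] at *
  induction n using forall_nat_mod_four with
  | h0 j =>
    rcases j with _ | j
    · have e1 : (if 0 = N then (1 : ℝ) else 0) + (if 2 * 0 < 2 * N then 0 else -1) = 0 := by
        rcases Nat.eq_zero_or_pos N with h | h
        · simp [h]
        · simp [h, h.ne]
      rw [pentaDual_zero, pentaSystem_zero]
      simp only [inner_add_left, real_inner_smul_left]
      linear_combination h00 0 + a (2 * 0) * h10 0 + c (2 * 0) * h20 0 + ha (2 * 0) + e1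
    · have e1 : (if j + 1 = N then (1 : ℝ) else 0) + (if 2 * (j + 1) < 2 * N then 0 else -1)
          - (if 2 * j + 1 < 2 * N then 0 else -1) = 0 := by
        split_ifs <;> first | omega | norm_num
      rw [pentaDual_four, pentaSystem_zero]
      simp only [inner_add_left, inner_sub_left, real_inner_smul_left]
      linear_combination h00 (j + 1) + a (2 * (j + 1)) * h10 (j + 1)
        + c (2 * (j + 1)) * h20 (j + 1) + d (2 * j + 1) * h24 j - b (2 * j + 1) * h34 j
        + ha (2 * (j + 1)) - hb (2 * j + 1) + e1
  | h1 j =>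
    rw [pentaDual_one, pentaSystem_one]
    simp only [inner_add_left, real_inner_smul_left]
    linear_combination h11 j - a (2 * j) * h10 j + b (2 * j) * h21 j
      - a (2 * j) * b (2 * j) * h20 j - ha (2 * j) + hb (2 * j) + δ (2 * j) * hcd (2 * j)
  | h2 j =>
    -- The threshold is even, so `2 * j` and `2 * j + 1` lie on the same side of it.
    have e1 : (if 2 * j + 1 < 2 * N then (0 : ℝ) else -1) = if 2 * j < 2 * N then 0 else -1 := by
      split_ifs <;> first | omega | rfl
    rw [pentaDual_two, pentaSystem_two]
    simp only [inner_add_left, inner_sub_left, real_inner_smul_left]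
    linear_combination h22 j + d (2 * j) * h20 j - b (2 * j) * h21 j + a (2 * j + 1) * h23 j
      + c (2 * j + 1) * h24 j - hb (2 * j) + ha (2 * j + 1) + e1
  | h3 j =>
    rw [pentaDual_three, pentaSystem_three]
    simp only [inner_add_left, inner_sub_left, real_inner_smul_left]
    linear_combination h33 j + b (2 * j + 1) * h34 j - a (2 * j + 1) * h23 j
      - a (2 * j + 1) * b (2 * j + 1) * h24 j - ha (2 * j + 1) + hb (2 * j + 1)
      + δ (2 * j + 1) * hcd (2 * j + 1)

/-- If `mu` has a summable tail then an operator of rank two annihilates the rank one algebra of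
the pentadiagonal system but not the identity. -/
theorem exists_rankTwoForm [CompleteSpace H] (e : HilbertBasis ℕ ℝ H) {a b c d : ℕ → ℝ}
    (hcd : ∀ n, c n + d n = a n * b n) (hμ : ¬ NotEllOne (mu a b c d)) :
    ∃ x y u v : H, inner ℝ x u + inner ℝ y v = 1 ∧
      ∀ n, rankTwoForm x y u v (pentaDual e a b c d n) (pentaSystem e a b c d n) = 0 := by
  obtain ⟨N, α, γ, δ, ha, hb, hαγδ, hs⟩ := exists_weights hcd hμ
  obtain ⟨ρ, θ, hρ, hρs, hαs, hγs, hδ⟩ := exists_polar hs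
  have i0 : Function.Injective fun j : ℕ => 2 * j := fun i j h => by simpa using h
  have i1 : Function.Injective fun j : ℕ => 2 * j + 1 := fun i j h => by simpa using h
  -- The polar vectors alternate: even ones are the `(u, v)` coordinates at `4 j`, odd ones the `(x,
  -- y)` coordinates at `4 j + 2`, and their products give `δ`. The remaining vectors are zero or
  -- parallel to one of these, scaled to produce `α`, `γ` or the entry 1.
  obtain ⟨x, y, p0, p1, p2, p3⟩ := exists_polar_coordinates e
    (r₀ := fun j => if j = N then 1 / ρ (2 * j) else 0) (r₁ := fun j => α (2 * j) / ρ (2 * j))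
    (r₂ := fun j => ρ (2 * j + 1)) (r₃ := fun j => γ (2 * j + 1) / ρ (2 * j + 1 + 1))
    (t₀ := fun j => θ (2 * j)) (t₁ := fun j => θ (2 * j)) (t₂ := fun j => θ (2 * j + 1))
    (t₃ := fun j => θ (2 * j + 1 + 1))
    (summable_of_ne_finset_zero (s := {N}) fun j hj => by
      simp only [Finset.mem_singleton] at hj
      simp [hj])
    (hαs.comp_injective i0) (hρs.comp_injective i1) (hγs.comp_injective i1)
  obtain ⟨u, v, q0, q1, q2, q3⟩ := exists_polar_coordinates e
    (r₀ := fun j => ρ (2 * j)) (r₁ := fun j => γ (2 * j) / ρ (2 * j + 1))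
    (r₂ := fun _ => 0) (r₃ := fun j => α (2 * j + 1) / ρ (2 * j + 1))
    (t₀ := fun j => θ (2 * j)) (t₁ := fun j => θ (2 * j + 1)) (t₂ := fun _ => 0)
    (t₃ := fun j => θ (2 * j + 1))
    (hρs.comp_injective i0) (hγs.comp_injective i0) (by simp [summable_zero])
    (hαs.comp_injective i1)
  have hself : ∀ t, Real.cos t * Real.cos t + Real.sin t * Real.sin t = 1 := fun t => by
    rw [← sq, ← sq, Real.cos_sq_add_sin_sq]
  have hcos : ∀ s t, Real.cos s * Real.cos t + Real.sin s * Real.sin t = Real.cos (s - t) :=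
    fun s t => (Real.cos_sub s t).symm
  have hne : ∀ n, ρ n ≠ 0 := fun n => (hρ n).ne'
  -- These are the diagonal entries at odd positions; they are multiples of `α γ δ`.
  have hQ : ∀ n, α n / ρ n * (γ n / ρ (n + 1)) * Real.cos (θ (n + 1) - θ n) = 0 := fun n => by
    have h1 : α n * γ n * (ρ n * ρ (n + 1) * Real.cos (θ (n + 1) - θ n)) = 0 := by
      rw [hδ, hαγδ]
    have h2 : α n / ρ n * (γ n / ρ (n + 1)) * Real.cos (θ (n + 1) - θ n) =
        α n * γ n * (ρ n * ρ (n + 1) * Real.cos (θ (n + 1) - θ n)) /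
          (ρ n * ρ (n + 1)) ^ 2 := by
      field_simp [hne n, hne (n + 1)]
    rw [h2, h1, zero_div]
  have h4 : ∀ j, 2 * (j + 1) = 2 * j + 1 + 1 := fun j => by ring
  have h00 : ∀ j, rankTwoForm x y u v (e (4 * j)) (e (4 * j)) = if j = N then 1 else 0 := by
    intro j
    simp only [rankTwoForm, p0, q0]
    split_ifs
    · have := hne (2 * j)
      field_simp
      linear_combination hself (θ (2 * j))
    · simp
  have h11 : ∀ j, rankTwoForm x y u v (e (4 * j + 1)) (e (4 * j + 1)) = 0 := fun j => by
    simp only [rankTwoForm, p1, q1]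
    linear_combination hQ (2 * j) + α (2 * j) / ρ (2 * j) * (γ (2 * j) / ρ (2 * j + 1)) *
      hcos (θ (2 * j + 1)) (θ (2 * j))
  have h22 : ∀ j, rankTwoForm x y u v (e (4 * j + 2)) (e (4 * j + 2)) = 0 := fun j => by
    simp [rankTwoForm, q2]
  have h33 : ∀ j, rankTwoForm x y u v (e (4 * j + 3)) (e (4 * j + 3)) = 0 := fun j => by
    simp only [rankTwoForm, p3, q3]
    linear_combination hQ (2 * j + 1) + α (2 * j + 1) / ρ (2 * j + 1) *
      (γ (2 * j + 1) / ρ (2 * j + 1 + 1)) * hcos (θ (2 * j + 1 + 1)) (θ (2 * j + 1))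
  have hdiv : ∀ (s r t : ℝ), r ≠ 0 →
      s / r * Real.cos t * (r * Real.cos t) + s / r * Real.sin t * (r * Real.sin t) = s := by
    intro s r t hr
    have : s / r * r = s := div_mul_cancel₀ s hr
    linear_combination (s / r * r) * hself t + this
  have hdiv' : ∀ (s r t : ℝ), r ≠ 0 →
      r * Real.cos t * (s / r * Real.cos t) + r * Real.sin t * (s / r * Real.sin t) = s := by
    intro s r t hr
    linear_combination hdiv s r t hr
  refine ⟨x, y, u, v, ?_, rankTwoForm_eq_zero hcd ha hb h00 h11 h22 h33 ?_ ?_ ?_ ?_ ?_ ?_⟩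
  -- By Parseval, the left side is the trace of the form, whose only nonzero diagonal entry is at `4
  -- * N`.
  · have hsum := (e.hasSum_inner_mul_inner x u).add (e.hasSum_inner_mul_inner y v)
    have hsingle : HasSum (fun m => inner ℝ x (e m) * inner ℝ (e m) u
        + inner ℝ y (e m) * inner ℝ (e m) v)
        (rankTwoForm x y u v (e (4 * N)) (e (4 * N))) := by
      have heq : (fun m => inner ℝ x (e m) * inner ℝ (e m) u
          + inner ℝ y (e m) * inner ℝ (e m) v) = fun m => rankTwoForm x y u v (e m) (e m) := by
        funext m
        rw [rankTwoForm, real_inner_comm x, real_inner_comm y]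
      rw [heq]
      refine hasSum_single (4 * N) fun m hm => ?_
      induction m using forall_nat_mod_four with
      | h0 j => rw [h00, if_neg (by omega)]
      | h1 j => exact h11 j
      | h2 j => exact h22 j
      | h3 j => exact h33 j
    rw [hsum.unique hsingle, h00, if_pos rfl]
  · intro j
    simp only [rankTwoForm, p1, q0]
    exact hdiv _ _ _ (hne _)
  · intro j
    simp only [rankTwoForm, p2, q1]
    exact hdiv' _ _ _ (hne _)
  · intro j
    simp only [rankTwoForm, p2, q0]
    linear_combination hδ (2 * j) + ρ (2 * j) * ρ (2 * j + 1) * hcos (θ (2 * j + 1)) (θ (2 * j))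
  · intro j
    simp only [rankTwoForm, p2, q3]
    exact hdiv' _ _ _ (hne _)
  · intro j
    simp only [rankTwoForm, p3, q0, h4]
    exact hdiv _ _ _ (hne _)
  · intro j
    simp only [rankTwoForm, p2, q0, h4]
    have hsymm := hcos (θ (2 * j + 1 + 1)) (θ (2 * j + 1))
    linear_combination hδ (2 * j + 1) + ρ (2 * j + 1) * ρ (2 * j + 1 + 1) * hsymm

theorem notEllOne_of_kPointDense [CompleteSpace H] (e : HilbertBasis ℕ ℝ H) {a b c d : ℕ → ℝ}
    (hcd : ∀ n, c n + d n = a n * b n) {k : ℕ} (hk : 1 < k)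
    (hf : KPointDense (pentaSystem e a b c d) k) : NotEllOne (mu a b c d) := by
  by_contra hμ
  obtain ⟨x, y, u, v, h1, hB⟩ := exists_rankTwoForm e hcd hμ
  have hb := isBiorthogonalBasis_pentaSystem (a := a) (b := b) (c := c) (d := d) e hcd
  have hann : ∀ T ∈ rankOneAlgebra (pentaSystem e a b c d),
      inner ℝ (T x) u + inner ℝ (T y) v = 0 := by
    intro T hT
    rw [hb.mem_rankOneAlgebra_iff] at hT
    induction hT using Submodule.span_induction with
    | mem T hT =>
      obtain ⟨n, rfl⟩ := hT
      simpa only [rankOne_apply, real_inner_smul_left, rankTwoForm] using hB n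
    | zero => simp
    | add S T _ _ hS hT =>
      simp only [add_apply, inner_add_left]
      linarith
    | smul r T _ hT =>
      simp only [smul_apply, real_inner_smul_left]
      linear_combination r * hT
  -- Errors below `1 / C` change the functional by less than 1, although it must differ by 1 between
  -- `T` and the identity.
  set C := ‖u‖ + ‖v‖ + 1 with hC
  have hC0 : 0 < C := by positivity
  obtain ⟨T, hT, hTx⟩ := hf (fun s => if (s : ℕ) = 0 then x else y) (1 / C) (by positivity)
  have hx : ‖T x - x‖ < 1 / C := by simpa using hTx ⟨0, by omega⟩
  have hy : ‖T y - y‖ < 1 / C := by simpa using hTx ⟨1, hk⟩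
  have h2 : inner ℝ (T x - x) u + inner ℝ (T y - y) v = (-1 : ℝ) := by
    rw [inner_sub_left, inner_sub_left]
    linarith [hann T hT]
  have h3 : |(inner ℝ (T x - x) u : ℝ)| ≤ 1 / C * ‖u‖ :=
    (abs_real_inner_le_norm _ _).trans (mul_le_mul_of_nonneg_right hx.le (norm_nonneg _))
  have h4 : |(inner ℝ (T y - y) v : ℝ)| ≤ 1 / C * ‖v‖ :=
    (abs_real_inner_le_norm _ _).trans (mul_le_mul_of_nonneg_right hy.le (norm_nonneg _))
  have h5 : 1 / C * ‖u‖ + 1 / C * ‖v‖ < 1 := by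
    rw [← mul_add, one_div, inv_mul_lt_one₀ hC0, hC]
    linarith
  linarith [(abs_le.1 h3).1, (abs_le.1 h4).1]

end Annihilator

end PentaBasis

theorem theorem4p2 {H : Type*} [NormedAddCommGroup H] [InnerProductSpace ℝ H] [CompleteSpace H]
    (e : HilbertBasis ℕ ℝ H) (a b c d : ℕ → ℝ) (hcd : ∀ n, c n + d n = a n * b n) :
    List.TFAE
      [PentaBasis.RankOneDense (PentaBasis.pentaSystem e a b c d),
       ∃ k : ℕ, 1 < k ∧ PentaBasis.KPointDense (PentaBasis.pentaSystem e a b c d) k,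
       ∀ k : ℕ, 1 < k → PentaBasis.KPointDense (PentaBasis.pentaSystem e a b c d) k,
       PentaBasis.NotEllOne (PentaBasis.mu a b c d)] := by
  tfae_have 1 → 3 := fun h k _ => h.kPointDense k
  tfae_have 3 → 2 := fun h => ⟨2, one_lt_two, h 2 one_lt_two⟩
  tfae_have 2 → 4 := fun ⟨_, hk, h⟩ => PentaBasis.notEllOne_of_kPointDense e hcd hk h
  tfae_have 4 → 1 := PentaBasis.rankOneDense_of_notEllOne e hcd
  tfae_finish
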